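/- Let $m, p, s, N$ be positive integers with $m \le p$, $s \le p$ and $p(m-1) \ge 50$, and let $\sigma, \sigma_a > 0$. Write $\|\cdot\|_F$ for the Frobenius norm, $\mathcal{D} \subset \mathbb{R}^{m\times p}$ for the set of matrices (dictionaries) whose columns all have Euclidean norm $1$, and, for $D_0 \in \mathcal{D}$ and $r>0$, $\mathcal{X}(D_0,r) = \{ D \in \mathcal{D} : \|D - D_0\|_F < r\}$. For $D \in \mathcal{D}$ consider the model $y = Dx + n$, where $n \sim \mathcal{N}(0, \sigma^2 I_m)$ is independent of $x$, and $x = P\,(z^T, 0_{1\times(p-s)})^T$ with $P$ a uniformly random $p\times p$ permutation matrix and $z \sim \mathcal{N}(0,\sigma_a^2 I_s)$ independent of $P$ (so $x$ has a uniformly random support of size $s$ and i.i.d. $\mathcal{N}(0,\sigma_a^2)$ nonzero entries). Let $Y = (y_1,\dots,y_N)$ consist of $N$ i.i.d. copies of $y$, and define the minimax risk $$\varepsilon^* = \inf_{\widehat D}\ \sup_{D \in \mathcal{X}(D_0,r)} \mathbb{E}_Y\big\{\|\widehat D(Y) - D\|_F^2\big\},$$ where the infimum is over all (measurable) estimators $\widehat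 D : \mathbb{R}^{m\times N}\to\mathbb{R}^{m\times p}$. Let $\mathrm{SNR} = \mathrm{SNR}(D) = \mathbb{E}\|Dx\|_2^2 / \mathbb{E}\|n\|_2^2$. Theorem. Let $D_0 \in \mathcal{D}$, $0 < r \le 2\sqrt{p}$, and let $D \in \mathcal{X}(D_0,r)$ (for instance $D = D_0$) satisfy the restricted isometry property of order $s$ with a constant $\delta_s \le 1/2$, i.e. $(1-\delta_s)\|z\|_2^2 \le \|Dz\|_2^2 \le (1+\delta_s)\|z\|_2^2$ for every $z\in\mathbb{R}^p$ with at most $s$ nonzero entries. If $\mathrm{SNR} \le \frac{1}{9\sqrt{80}}\cdot\frac{m}{2s}$, then $$\varepsilon^* \ \ge\ \frac{1}{12960}\,\min\left\{ \frac{r^2}{s},\ \frac{p}{\mathrm{SNR}^2\, N\, m^2}\left(\frac{p(m-1)}{10} - 1\right)\right\}.$$ -/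

import Mathlib

open MeasureTheory ProbabilityTheory
open scoped ENNReal Nat Matrix

noncomputable section

namespace DictLearn

/-- Frobenius norm `‖A‖_F = √(Tr (A Aᵀ))`. -/
def frobNorm {m p : ℕ} (A : Matrix (Fin m) (Fin p) ℝ) : ℝ :=
  √((A * Aᵀ).trace)

/-- Euclidean norm of a vector. -/
def euclNorm {n : ℕ} (v : Fin n → ℝ) : ℝ :=
  ‖WithLp.toLp 2 v‖

/-- The dictionaries with normalized columns (oblique manifold). -/
def obliqueManifold (m p : ℕ) : Set (Matrix (Fin m) (Fin p) ℝ) :=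
  {B | ∀ k, (Bᵀ * B) k k = 1}

/-- The dictionaries with normalized columns in the open Frobenius ball around `D₀`. -/
def neighborhood {m p : ℕ} (D₀ : Matrix (Fin m) (Fin p) ℝ) (r : ℝ) :
    Set (Matrix (Fin m) (Fin p) ℝ) :=
  {D | D ∈ obliqueManifold m p ∧ frobNorm (D - D₀) < r}

/-- Restricted isometry property of order `s` with constant `δ`;
`hammingNorm z` is the number of non-zero entries of `z`. -/
def RIP {m p : ℕ} (D : Matrix (Fin m) (Fin p) ℝ) (s : ℕ) (δ : ℝ) : Prop :=
  ∀ z : Fin p → ℝ, hammingNorm z ≤ s →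
    (1 - δ) * euclNorm z ^ 2 ≤ euclNorm (D *ᵥ z) ^ 2 ∧
      euclNorm (D *ᵥ z) ^ 2 ≤ (1 + δ) * euclNorm z ^ 2

/-- Law of a vector in `ℝⁿ` with i.i.d. entries `N(0, τ²)`. -/
def iidGaussian (n : ℕ) (τ : ℝ) : Measure (Fin n → ℝ) :=
  Measure.pi fun _ => gaussianReal 0 (τ ^ 2).toNNReal

/-- The vector `(zᵀ, 0)ᵀ ∈ ℝᵖ` (for `s ≤ p`). -/
def zeroPad (p : ℕ) {s : ℕ} (z : Fin s → ℝ) : Fin p → ℝ :=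
  fun i => if h : (i : ℕ) < s then z ⟨i, h⟩ else 0

/-- Law of the coefficient vector `x = P (zᵀ, 0)ᵀ`, where `P` is a uniformly random `p × p`
permutation matrix, independent of `z ~ N(0, σₐ² I_s)`: the average over all `p !`
permutation matrices of the laws of `P (zᵀ, 0)ᵀ` with `P` fixed. -/
def coeffLaw (p s : ℕ) (σa : ℝ) : Measure (Fin p → ℝ) :=
  (p ! : ℝ≥0∞)⁻¹ • ∑ π : Equiv.Perm (Fin p),
    (iidGaussian s σa).map fun z => π.permMatrix ℝ *ᵥ zeroPad p z

/-- Law of one observation `y = D x + n`, with `x` as in `coeffLaw` and independent white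
Gaussian noise `n ~ N(0, σ² I_m)`. -/
def obsLaw {m p : ℕ} (s : ℕ) (σa σ : ℝ) (D : Matrix (Fin m) (Fin p) ℝ) :
    Measure (Fin m → ℝ) :=
  ((coeffLaw p s σa).prod (iidGaussian m σ)).map fun xn => D *ᵥ xn.1 + xn.2

/-- Law of the data `Y = (y₁, …, y_N)`: `N` i.i.d. observations. -/
def dataLaw {m p : ℕ} (N s : ℕ) (σa σ : ℝ) (D : Matrix (Fin m) (Fin p) ℝ) :
    Measure (Fin N → Fin m → ℝ) :=
  Measure.pi fun _ => obsLaw s σa σ D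

/-- Signal-to-noise ratio `E ‖D x‖² / E ‖n‖²`. -/
def SNR {m p : ℕ} (s : ℕ) (σa σ : ℝ) (D : Matrix (Fin m) (Fin p) ℝ) : ℝ :=
  (∫ x, euclNorm (D *ᵥ x) ^ 2 ∂coeffLaw p s σa) / (∫ n, euclNorm n ^ 2 ∂iidGaussian m σ)

/-- Mean squared error `E_Y ‖D̂(Y) - D‖_F²` of an estimator when `D` is the true dictionary. -/
def mse {m p : ℕ} (N s : ℕ) (σa σ : ℝ)
    (est : (Fin N → Fin m → ℝ) → Matrix (Fin m) (Fin p) ℝ)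
    (D : Matrix (Fin m) (Fin p) ℝ) : ℝ≥0∞ :=
  ∫⁻ Y, ENNReal.ofReal (frobNorm (est Y - D) ^ 2) ∂dataLaw N s σa σ D

/-- Minimax risk: infimum over all (measurable) estimators of the worst-case mean squared
error over `neighborhood D₀ r`, a value in `[0, ∞]`. Measurability is entrywise. -/
def minimaxRisk {m p : ℕ} (N s : ℕ) (σa σ : ℝ) (D₀ : Matrix (Fin m) (Fin p) ℝ) (r : ℝ) :
    ℝ≥0∞ :=
  ⨅ est : {f : (Fin N → Fin m → ℝ) → Matrix (Fin m) (Fin p) ℝ //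
      ∀ i j, Measurable fun Y => f Y i j},
    ⨆ D ∈ neighborhood D₀ r, mse N s σa σ est.1 D

end DictLearn

end

/-!
Assouad's method, localized at `D₀`. Each column `D₀ᵀ k` of `D₀` is moved on the unit sphere by a
small step with tangent coordinates `b ε_{kj}`, where the signs `ε_{kj}` range over a hypercube.
The `(k, j)` tangent coordinate of any estimator estimates `b ε_{kj}`, and flipping one sign
changes only the column `k`. Hence an estimator pays of order `b²` for each of the `p (m - 1)`
signs, as long as a flip changes the law of the data by at most a constant in Kullback–Leibler
divergence.

To bound that divergence, condition on the support of `x`: by joint convexity the mixture over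
supports is at most the average over supports, and a support that misses `k` contributes nothing,
which gains the factor `s / p`. Given a support that contains `k`, the remaining atoms act as an
independent convolution, which cannot increase the divergence; what is left is the divergence of
two Gaussians `N(0, σ² I + σₐ² d dᵀ)` with unit vectors `d`, which is at most
`(σₐ² / σ²)² / 2 * ‖d - d'‖²`.
-/

noncomputable section

namespace DictLearn

open InformationTheory
open scoped NNReal

section KullbackLeibler

variable {α β : Type*} {mα : MeasurableSpace α} {mβ : MeasurableSpace β}

lemma klDiv_prod_le (μ₁ μ₂ : Measure α) (ν₁ ν₂ : Measure β) [IsProbabilityMeasure μ₁]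
    [IsProbabilityMeasure μ₂] [IsProbabilityMeasure ν₁] [IsProbabilityMeasure ν₂] :
    klDiv (μ₁.prod ν₁) (μ₂.prod ν₂) ≤ klDiv μ₁ μ₂ + klDiv ν₁ ν₂ := by
  have swap_right : klDiv (μ₁.prod ν₁) (μ₁.prod ν₂) ≤ klDiv ν₁ ν₂ := by
    rw [← Measure.prod_swap (μ := ν₁), ← Measure.prod_swap (μ := ν₂)]
    refine (klDiv_map_le _ _ measurable_swap).trans_eq ?_
    rw [← Measure.compProd_const, ← Measure.compProd_const, klDiv_compProd_left]
  rw [← Measure.compProd_const, ← Measure.compProd_const, klDiv_compProd_eq_add]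
  simpa only [Measure.compProd_const] using add_le_add_right swap_right (klDiv μ₁ μ₂)

lemma klDiv_pi_const_le (n : ℕ) (μ ν : Measure α) [IsProbabilityMeasure μ]
    [IsProbabilityMeasure ν] :
    klDiv (Measure.pi fun _ : Fin n => μ) (Measure.pi fun _ : Fin n => ν) ≤ n * klDiv μ ν := by
  induction n with
  | zero => rw [Measure.pi_of_empty, Measure.pi_of_empty, klDiv_self]; exact zero_le
  | succ n ih =>
    have split (ρ : Measure α) [IsProbabilityMeasure ρ] :
        Measure.pi (fun _ : Fin (n + 1) => ρ) =
          (ρ.prod (Measure.pi fun _ : Fin n => ρ)).map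
            (MeasurableEquiv.piFinSuccAbove (fun _ => α) 0).symm :=
      (measurePreserving_piFinSuccAbove (fun _ => ρ) 0).symm.map_eq.symm
    calc klDiv (Measure.pi fun _ : Fin (n + 1) => μ) (Measure.pi fun _ => ν)
        ≤ klDiv (μ.prod (Measure.pi fun _ : Fin n => μ))
            (ν.prod (Measure.pi fun _ : Fin n => ν)) := by
          rw [split μ, split ν]
          exact klDiv_map_le _ _ (MeasurableEquiv.measurable _)
      _ ≤ klDiv μ ν + n * klDiv μ ν := (klDiv_prod_le _ _ _ _).trans (by gcongr)
      _ = (n + 1 : ℕ) * klDiv μ ν := by push_cast; ring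

lemma klDiv_conv_left_le {G : Type*} [AddMonoid G] [MeasurableSpace G] [MeasurableAdd₂ G]
    (τ μ ν : Measure G) [IsProbabilityMeasure τ] [IsProbabilityMeasure μ]
    [IsProbabilityMeasure ν] : klDiv (τ ∗ μ) (τ ∗ ν) ≤ klDiv μ ν :=
  calc klDiv (τ ∗ μ) (τ ∗ ν) ≤ klDiv (τ.prod μ) (τ.prod ν) := klDiv_map_le _ _ measurable_add
    _ ≤ klDiv τ τ + klDiv μ ν := klDiv_prod_le _ _ _ _
    _ = klDiv μ ν := by rw [klDiv_self, zero_add]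

lemma ofReal_klFun_add_le {a b x y : ℝ≥0∞} (hab : a + b = 1) (hx : x * a ≠ ∞) (hy : y * b ≠ ∞) :
    ENNReal.ofReal (klFun (x * a + y * b).toReal) ≤
      a * ENNReal.ofReal (klFun x.toReal) + b * ENNReal.ofReal (klFun y.toReal) := by
  have ha : a ≠ ∞ := ne_top_of_le_ne_top ENNReal.one_ne_top (hab ▸ le_self_add)
  have hb : b ≠ ∞ := ne_top_of_le_ne_top ENNReal.one_ne_top (hab ▸ le_add_self)
  have weights : a.toReal + b.toReal = 1 := by
    rw [← ENNReal.toReal_add ha hb, hab, ENNReal.toReal_one]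
  have convex := convexOn_klFun.2 (Set.mem_Ici.2 x.toReal_nonneg) (Set.mem_Ici.2 y.toReal_nonneg)
    a.toReal_nonneg b.toReal_nonneg weights
  have mean : (x * a + y * b).toReal = a.toReal • x.toReal + b.toReal • y.toReal := by
    rw [ENNReal.toReal_add hx hy, ENNReal.toReal_mul, ENNReal.toReal_mul, smul_eq_mul, smul_eq_mul,
      mul_comm x.toReal, mul_comm y.toReal]
  have klFun_x := klFun_nonneg x.toReal_nonneg
  have klFun_y := klFun_nonneg y.toReal_nonneg
  calc ENNReal.ofReal (klFun (x * a + y * b).toReal)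
      ≤ ENNReal.ofReal (a.toReal * klFun x.toReal + b.toReal * klFun y.toReal) := by
        rw [mean]
        exact ENNReal.ofReal_le_ofReal convex
    _ = a * ENNReal.ofReal (klFun x.toReal) + b * ENNReal.ofReal (klFun y.toReal) := by
        rw [ENNReal.ofReal_add (by positivity) (by positivity),
          ENNReal.ofReal_mul a.toReal_nonneg, ENNReal.ofReal_mul b.toReal_nonneg,
          ENNReal.ofReal_toReal ha, ENNReal.ofReal_toReal hb]

lemma klDiv_add_le (μ₁ μ₂ ν₁ ν₂ : Measure α) [IsFiniteMeasure μ₁] [IsFiniteMeasure μ₂]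
    [IsFiniteMeasure ν₁] [IsFiniteMeasure ν₂] :
    klDiv (μ₁ + μ₂) (ν₁ + ν₂) ≤ klDiv μ₁ ν₁ + klDiv μ₂ ν₂ := by
  by_cases hac₁ : μ₁ ≪ ν₁; swap
  · simp [klDiv_of_not_ac hac₁]
  by_cases hac₂ : μ₂ ≪ ν₂; swap
  · simp [klDiv_of_not_ac hac₂]
  set ν := ν₁ + ν₂
  have hν₁ : ν₁ ≪ ν := rfl.absolutelyContinuous.add_right _
  have hν₂ : ν₂ ≪ ν := rfl.absolutelyContinuous.add_right' _
  have weights : ν₁.rnDeriv ν + ν₂.rnDeriv ν =ᵐ[ν] 1 :=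
    (Measure.rnDeriv_add' ν₁ ν₂ ν).symm.trans (Measure.rnDeriv_self ν)
  have density : (μ₁ + μ₂).rnDeriv ν =ᵐ[ν]
      μ₁.rnDeriv ν₁ * ν₁.rnDeriv ν + μ₂.rnDeriv ν₂ * ν₂.rnDeriv ν :=
    (Measure.rnDeriv_add' μ₁ μ₂ ν).trans
      ((Measure.rnDeriv_mul_rnDeriv hac₁).add (Measure.rnDeriv_mul_rnDeriv hac₂)).symm
  rw [klDiv_eq_lintegral_klFun_of_ac ((hac₁.trans hν₁).add_left (hac₂.trans hν₂)),
    klDiv_eq_lintegral_klFun_of_ac hac₁, klDiv_eq_lintegral_klFun_of_ac hac₂,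
    ← lintegral_rnDeriv_mul hν₁ (by fun_prop), ← lintegral_rnDeriv_mul hν₂ (by fun_prop),
    ← lintegral_add_left (by fun_prop)]
  refine lintegral_mono_ae ?_
  filter_upwards [weights, density, Measure.rnDeriv_mul_rnDeriv hac₁ (κ := ν),
    Measure.rnDeriv_mul_rnDeriv hac₂ (κ := ν), Measure.rnDeriv_ne_top μ₁ ν,
    Measure.rnDeriv_ne_top μ₂ ν] with x hw hd h₁ h₂ fin₁ fin₂
  rw [hd]
  exact ofReal_klFun_add_le hw (h₁.trans_ne fin₁) (h₂.trans_ne fin₂)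

lemma klDiv_finsetSum_le {ι : Type*} (s : Finset ι) (μ ν : ι → Measure α)
    [∀ i, IsFiniteMeasure (μ i)] [∀ i, IsFiniteMeasure (ν i)] :
    klDiv (∑ i ∈ s, μ i) (∑ i ∈ s, ν i) ≤ ∑ i ∈ s, klDiv (μ i) (ν i) := by
  classical
  induction s using Finset.induction_on with
  | empty => simp
  | insert i s hi ih =>
    simp only [Finset.sum_insert hi]
    exact (klDiv_add_le _ _ _ _).trans (by gcongr)

end KullbackLeibler

section TwoPoint

variable {Ω : Type*} {mΩ : MeasurableSpace Ω}

lemma sq_one_sub_sqrt_le_klFun {x : ℝ} (hx : 0 ≤ x) : (1 - √x) ^ 2 ≤ klFun x := by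
  rcases hx.eq_or_lt with rfl | hx
  · simp [klFun_zero]
  have log_sqrt : 1 - (√x)⁻¹ ≤ Real.log √x := Real.one_sub_inv_le_log_of_pos (Real.sqrt_pos.2 hx)
  have log_bound : 2 * (1 - (√x)⁻¹) ≤ Real.log x := by
    rw [Real.log_sqrt hx.le] at log_sqrt
    linarith
  have sq : x * (√x)⁻¹ = √x := by rw [← div_eq_mul_inv, Real.div_sqrt]
  calc (1 - √x) ^ 2 = x * (2 * (1 - (√x)⁻¹)) + 1 - x := by
        rw [sub_sq, Real.sq_sqrt hx.le]
        linear_combination 2 * sq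
    _ ≤ klFun x := by
        rw [klFun_apply]
        gcongr

lemma two_point_pointwise {x : ℝ} (hx : 0 ≤ x) (u v : ℝ) :
    (u - v) ^ 2 / 4 * (1 + x) ≤ x * u ^ 2 + v ^ 2 + (u - v) ^ 2 / 2 * klFun x := by
  have parallel : (u - v) ^ 2 * x ≤ (1 + x) * (x * u ^ 2 + v ^ 2) := by
    linarith [sq_nonneg (x * u + v)]
  have hellinger : (1 - x) ^ 2 ≤ 2 * (1 + x) * klFun x :=
    calc (1 - x) ^ 2 = (1 + √x) ^ 2 * (1 - √x) ^ 2 := by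
          rw [← mul_pow, show (1 + √x) * (1 - √x) = 1 - √x ^ 2 by ring, Real.sq_sqrt hx]
      _ ≤ 2 * (1 + x) * klFun x := by
          gcongr
          · linarith [sq_nonneg (1 - √x), Real.sq_sqrt hx]
          · exact sq_one_sub_sqrt_le_klFun hx
  refine le_of_mul_le_mul_left ?_ (by positivity : 0 < 1 + x)
  linarith [mul_le_mul_of_nonneg_left hellinger (sq_nonneg (u - v))]

lemma ofReal_two_point_pointwise {x : ℝ≥0∞} (hx : x ≠ ∞) (u v : ℝ) :
    ENNReal.ofReal ((u - v) ^ 2 / 4) * (1 + x) ≤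
      x * ENNReal.ofReal (u ^ 2) + ENNReal.ofReal (v ^ 2) +
        ENNReal.ofReal ((u - v) ^ 2 / 2) * ENNReal.ofReal (klFun x.toReal) := by
  lift x to ℝ≥0 using hx
  have hx := x.coe_nonneg
  have klFun_nonneg := klFun_nonneg hx
  rw [ENNReal.coe_toReal, ← ENNReal.ofReal_coe_nnreal, ← ENNReal.ofReal_one,
    ← ENNReal.ofReal_add zero_le_one hx, ← ENNReal.ofReal_mul (by positivity),
    ← ENNReal.ofReal_mul hx, ← ENNReal.ofReal_mul (by positivity),
    ← ENNReal.ofReal_add (by positivity) (by positivity),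
    ← ENNReal.ofReal_add (by positivity) (by positivity)]
  exact ENNReal.ofReal_le_ofReal (two_point_pointwise hx u v)

lemma ofReal_sq_le_two_point_risk_add_klDiv (P Q : Measure Ω) [IsProbabilityMeasure P]
    [IsProbabilityMeasure Q] {f : Ω → ℝ} (hf : Measurable f) (a b : ℝ) :
    ENNReal.ofReal ((a - b) ^ 2 / 2) ≤
      ∫⁻ ω, ENNReal.ofReal ((f ω - a) ^ 2) ∂P + ∫⁻ ω, ENNReal.ofReal ((f ω - b) ^ 2) ∂Q +
        ENNReal.ofReal ((a - b) ^ 2 / 2) * klDiv P Q := by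
  rcases eq_or_ne a b with rfl | hab
  · simp
  by_cases hac : P ≪ Q; swap
  · simp [klDiv_of_not_ac hac, ENNReal.mul_top, sub_ne_zero.2 hab, sq_pos_of_ne_zero]
  have pointwise : ∀ᵐ ω ∂Q, ENNReal.ofReal ((a - b) ^ 2 / 4) * (1 + P.rnDeriv Q ω) ≤
      P.rnDeriv Q ω * ENNReal.ofReal ((f ω - a) ^ 2) + ENNReal.ofReal ((f ω - b) ^ 2) +
        ENNReal.ofReal ((a - b) ^ 2 / 2) * ENNReal.ofReal (klFun (P.rnDeriv Q ω).toReal) := by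
    filter_upwards [P.rnDeriv_ne_top Q] with ω hω
    have bound := ofReal_two_point_pointwise hω (f ω - a) (f ω - b)
    rwa [sub_sub_sub_cancel_left, sub_sq_comm b a] at bound
  calc ENNReal.ofReal ((a - b) ^ 2 / 2)
      = ∫⁻ ω, ENNReal.ofReal ((a - b) ^ 2 / 4) * (1 + P.rnDeriv Q ω) ∂Q := by
        rw [lintegral_const_mul _ (by fun_prop), lintegral_add_left (by fun_prop), lintegral_one,
          Measure.lintegral_rnDeriv hac, measure_univ, measure_univ, one_add_one_eq_two,
          ← ENNReal.ofReal_ofNat, ← ENNReal.ofReal_mul (by positivity)]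
        ring_nf
    _ ≤ _ := lintegral_mono_ae pointwise
    _ = _ := by
        rw [lintegral_add_left (by fun_prop), lintegral_add_left (by fun_prop),
          lintegral_rnDeriv_mul hac (by fun_prop), lintegral_const_mul _ (by fun_prop),
          klDiv_eq_lintegral_klFun_of_ac hac]

lemma ofReal_sq_le_two_point_risk {P Q : Measure Ω} [IsProbabilityMeasure P]
    [IsProbabilityMeasure Q] (hPQ : klDiv P Q ≤ 2⁻¹) {f : Ω → ℝ} (hf : Measurable f) (a b : ℝ) :
    ENNReal.ofReal ((a - b) ^ 2 / 4) ≤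
      ∫⁻ ω, ENNReal.ofReal ((f ω - a) ^ 2) ∂P + ∫⁻ ω, ENNReal.ofReal ((f ω - b) ^ 2) ∂Q := by
  have half : ENNReal.ofReal ((a - b) ^ 2 / 2) * 2⁻¹ = ENNReal.ofReal ((a - b) ^ 2 / 4) := by
    rw [← ENNReal.ofReal_ofNat, ← ENNReal.ofReal_inv_of_pos two_pos,
      ← ENNReal.ofReal_mul (by positivity)]
    ring_nf
  refine ENNReal.le_of_add_le_add_right (ENNReal.ofReal_ne_top (r := (a - b) ^ 2 / 4)) ?_
  calc ENNReal.ofReal ((a - b) ^ 2 / 4) + ENNReal.ofReal ((a - b) ^ 2 / 4)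
      = ENNReal.ofReal ((a - b) ^ 2 / 2) := by
        rw [← ENNReal.ofReal_add (by positivity) (by positivity)]
        ring_nf
    _ ≤ _ := ofReal_sq_le_two_point_risk_add_klDiv P Q hf a b
    _ ≤ _ := by
        rw [← half]
        gcongr

end TwoPoint

section Assouad

variable {Ω J : Type*} {mΩ : MeasurableSpace Ω} [DecidableEq J]

lemma sq_intCast_sign (u : ℤˣ) : ((u : ℤ) : ℝ) ^ 2 = 1 := by
  rw [← Int.cast_pow, ← Units.val_pow_eq_pow_val, Int.units_sq, Units.val_one, Int.cast_one]

/-- The sign vector obtained from `ε` by flipping the sign of its entry `j`. -/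
def flipSign (j : J) (ε : J → ℤˣ) : J → ℤˣ :=
  Function.update ε j (-ε j)

lemma flipSign_involutive (j : J) : Function.Involutive (flipSign j) := fun ε => by
  simp [flipSign]

variable [Fintype J]

lemma card_mul_le_sum_of_flipSign (j : J) {F : (J → ℤˣ) → ℝ≥0∞} {c : ℝ≥0∞}
    (hF : ∀ ε, 2 * c ≤ F ε + F (flipSign j ε)) : Fintype.card (J → ℤˣ) * c ≤ ∑ ε, F ε := by
  have reindex : ∑ ε, F (flipSign j ε) = ∑ ε, F ε :=
    Equiv.sum_comp (flipSign_involutive j).toPerm F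
  rw [← ENNReal.mul_le_mul_iff_right two_ne_zero ENNReal.ofNat_ne_top]
  calc 2 * (Fintype.card (J → ℤˣ) * c) = ∑ _ε : J → ℤˣ, 2 * c := by
        rw [Finset.sum_const, Finset.card_univ, nsmul_eq_mul]
        ring
    _ ≤ ∑ ε, (F ε + F (flipSign j ε)) := Finset.sum_le_sum fun ε _ => hF ε
    _ = 2 * ∑ ε, F ε := by rw [Finset.sum_add_distrib, reindex, two_mul]

theorem assouad (P : (J → ℤˣ) → Measure Ω) [∀ ε, IsProbabilityMeasure (P ε)]
    (hP : ∀ j ε, klDiv (P ε) (P (flipSign j ε)) ≤ 2⁻¹) {f : Ω → J → ℝ}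
    (hf : ∀ j, Measurable fun ω => f ω j) (b : ℝ) :
    ENNReal.ofReal (Fintype.card J * b ^ 2 / 2) ≤
      ⨆ ε, ∫⁻ ω, ENNReal.ofReal (∑ j, (f ω j - b * (ε j : ℤ)) ^ 2) ∂P ε := by
  set risk : J → (J → ℤˣ) → ℝ≥0∞ :=
    fun j ε => ∫⁻ ω, ENNReal.ofReal ((f ω j - b * (ε j : ℤ)) ^ 2) ∂P ε
  have flip_risk (j : J) (ε : J → ℤˣ) :
      2 * ENNReal.ofReal (b ^ 2 / 2) ≤ risk j ε + risk j (flipSign j ε) := by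
    have gap : (b * (ε j : ℤ) - b * (flipSign j ε j : ℤ)) ^ 2 / 4 = 2 * (b ^ 2 / 2) := by
      simp only [flipSign, Function.update_self, Units.val_neg, Int.cast_neg]
      linear_combination b ^ 2 * sq_intCast_sign (ε j)
    rw [← ENNReal.ofReal_ofNat, ← ENNReal.ofReal_mul zero_le_two, ← gap]
    exact ofReal_sq_le_two_point_risk (hP j ε) (hf j) _ _
  have risk_sum (ε : J → ℤˣ) :
      ∫⁻ ω, ENNReal.ofReal (∑ j, (f ω j - b * (ε j : ℤ)) ^ 2) ∂P ε = ∑ j, risk j ε := by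
    simp_rw [ENNReal.ofReal_sum_of_nonneg fun _ _ => sq_nonneg _]
    exact lintegral_finsetSum _ fun j _ => by fun_prop
  simp_rw [risk_sum]
  refine (ENNReal.mul_le_mul_iff_right (Nat.cast_ne_zero.2 Fintype.card_ne_zero)
    (ENNReal.natCast_ne_top (Fintype.card (J → ℤˣ)))).1 ?_
  calc Fintype.card (J → ℤˣ) * ENNReal.ofReal (Fintype.card J * b ^ 2 / 2)
      = ∑ _j : J, Fintype.card (J → ℤˣ) * ENNReal.ofReal (b ^ 2 / 2) := by
        rw [Finset.sum_const, Finset.card_univ, nsmul_eq_mul, mul_div_assoc,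
          ENNReal.ofReal_mul (Nat.cast_nonneg _), ENNReal.ofReal_natCast]
        ring
    _ ≤ ∑ j, ∑ ε, risk j ε :=
        Finset.sum_le_sum fun j _ => card_mul_le_sum_of_flipSign j (flip_risk j)
    _ = ∑ ε, ∑ j, risk j ε := Finset.sum_comm
    _ ≤ ∑ _ε : J → ℤˣ, ⨆ ε, ∑ j, risk j ε :=
        Finset.sum_le_sum fun ε _ => le_iSup (fun ε => ∑ j, risk j ε) ε
    _ = Fintype.card (J → ℤˣ) * ⨆ ε, ∑ j, risk j ε := by
        rw [Finset.sum_const, Finset.card_univ, nsmul_eq_mul]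

end Assouad

section Density

variable {α : Type*} {mα : MeasurableSpace α}

lemma klDiv_eq_ofReal_integral_of_withDensity_exp {μ ν : Measure α} [IsProbabilityMeasure μ]
    [IsProbabilityMeasure ν] {ℓ : α → ℝ} (hℓ : Measurable ℓ)
    (hμ : μ = ν.withDensity fun x => ENNReal.ofReal (Real.exp (ℓ x))) (hint : Integrable ℓ μ) :
    klDiv μ ν = ENNReal.ofReal (∫ x, ℓ x ∂μ) := by
  have hac : μ ≪ ν := hμ ▸ withDensity_absolutelyContinuous _ _
  have llr_eq : llr μ ν =ᵐ[μ] ℓ := by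
    have density := Measure.rnDeriv_withDensity ν (f := fun x => ENNReal.ofReal (Real.exp (ℓ x)))
      (by fun_prop)
    rw [← hμ] at density
    filter_upwards [hac.ae_le density] with x hx
    simp only [llr_def]
    rw [hx, ENNReal.toReal_ofReal (Real.exp_pos _).le, Real.log_exp]
  rw [klDiv_of_ac_of_integrable hac (hint.congr llr_eq.symm), integral_congr_ae llr_eq]
  simp

lemma pi_withDensity {ι : Type*} [Fintype ι] {E : ι → Type*} [∀ i, MeasurableSpace (E i)]
    (μ : ∀ i, Measure (E i)) [∀ i, IsProbabilityMeasure (μ i)] {f : ∀ i, E i → ℝ≥0∞}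
    (hf : ∀ i, Measurable (f i)) [∀ i, SigmaFinite ((μ i).withDensity (f i))] :
    Measure.pi (fun i => (μ i).withDensity (f i)) =
      (Measure.pi μ).withDensity fun x => ∏ i, f i (x i) := by
  refine (Measure.pi_eq fun s hs => ?_)
  have indicator_prod (x : ∀ i, E i) :
      (Set.univ.pi s).indicator (fun x => ∏ i, f i (x i)) x =
        ∏ i, (s i).indicator (f i) (x i) := by
    by_cases hx : x ∈ Set.univ.pi s
    · rw [Set.indicator_of_mem hx]
      exact Finset.prod_congr rfl fun i _ => (Set.indicator_of_mem (hx i trivial) _).symm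
    · obtain ⟨i, hi⟩ : ∃ i, x i ∉ s i := by simpa [Set.mem_univ_pi] using hx
      rw [Set.indicator_of_notMem hx,
        Finset.prod_eq_zero (Finset.mem_univ i) (Set.indicator_of_notMem hi _)]
  have indep : iIndepFun (fun i (x : ∀ i, E i) => (s i).indicator (f i) (x i)) (Measure.pi μ) :=
    iIndepFun_pi fun i => ((hf i).indicator (hs i)).aemeasurable
  rw [withDensity_apply _ (MeasurableSet.univ_pi hs),
    ← lintegral_indicator (MeasurableSet.univ_pi hs), lintegral_congr indicator_prod,
    lintegral_prod_eq_prod_lintegral_of_indepFun Finset.univ _ indep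
      fun i => ((hf i).indicator (hs i)).comp (measurable_pi_apply i)]
  refine Finset.prod_congr rfl fun i _ => ?_
  rw [(measurePreserving_eval μ i).lintegral_comp ((hf i).indicator (hs i)),
    lintegral_indicator (hs i), withDensity_apply _ (hs i)]

end Density

section Gaussian

variable {ι : Type*} [Fintype ι]

/-- The law of a vector of independent centred Gaussian entries, the entry `i` having variance
`V i` (possibly zero). -/
abbrev indepGaussian (V : ι → ℝ≥0) : Measure (ι → ℝ) :=
  Measure.pi fun i => gaussianReal 0 (V i)

@[fun_prop]
lemma measurable_dotProduct_left (w : ι → ℝ) : Measurable fun y : ι → ℝ => w ⬝ᵥ y := by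
  unfold dotProduct
  fun_prop

lemma memLp_apply_indepGaussian (V : ι → ℝ≥0) (i : ι) :
    MemLp (fun y => y i) 2 (indepGaussian V) :=
  (memLp_id_gaussianReal 2).comp_measurePreserving
    (measurePreserving_eval (fun i => gaussianReal 0 (V i)) i)

lemma memLp_dotProduct_indepGaussian (V : ι → ℝ≥0) (w : ι → ℝ) :
    MemLp (fun y => w ⬝ᵥ y) 2 (indepGaussian V) :=
  memLp_finsetSum _ fun i _ => (memLp_apply_indepGaussian V i).const_mul (w i)

lemma integral_dotProduct_indepGaussian (V : ι → ℝ≥0) (w : ι → ℝ) :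
    ∫ y, w ⬝ᵥ y ∂indepGaussian V = 0 := by
  have centred (i : ι) : ∫ y, y i ∂indepGaussian V = 0 :=
    (integral_comp_eval (μ := fun i => gaussianReal 0 (V i)) (f := fun x : ℝ => x)
      (by fun_prop)).trans integral_id_gaussianReal
  simp only [dotProduct]
  rw [integral_finsetSum _ fun i _ =>
    ((memLp_apply_indepGaussian V i).integrable one_le_two).const_mul (w i)]
  simp only [integral_const_mul, centred, mul_zero, Finset.sum_const_zero]

lemma integral_sq_dotProduct_indepGaussian (V : ι → ℝ≥0) (w : ι → ℝ) :
    ∫ y, (w ⬝ᵥ y) ^ 2 ∂indepGaussian V = ∑ i, V i * w i ^ 2 := by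
  have variance_sum := variance_sum_pi (μ := fun i => gaussianReal 0 (V i))
    (X := fun i x => w i * x) fun i => (memLp_id_gaussianReal 2).const_mul (w i)
  have sum_eq : (∑ i, fun y : ι → ℝ => w i * y i) = fun y => w ⬝ᵥ y := by
    ext y
    simp [dotProduct]
  rw [sum_eq, variance_of_integral_eq_zero (by fun_prop)
    (integral_dotProduct_indepGaussian V w)] at variance_sum
  refine variance_sum.trans (Finset.sum_congr rfl fun i _ => ?_)
  rw [variance_const_mul (w i) fun x => x, variance_fun_id_gaussianReal, mul_comm]

lemma gaussianReal_eq_withDensity_gaussianReal_zero {τ : ℝ≥0} (hτ : τ ≠ 0) (c : ℝ) :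
    gaussianReal c τ = (gaussianReal 0 τ).withDensity fun x =>
      ENNReal.ofReal (Real.exp ((c * x - c ^ 2 / 2) / τ)) := by
  rw [gaussianReal_of_var_ne_zero _ hτ, gaussianReal_of_var_ne_zero _ hτ,
    ← withDensity_mul _ (measurable_gaussianPDF _ _) (by fun_prop)]
  congr 1
  ext x
  have hτ' : (τ : ℝ) ≠ 0 := by exact_mod_cast hτ
  simp only [Pi.mul_apply, gaussianPDF]
  rw [← ENNReal.ofReal_mul (gaussianPDFReal_nonneg _ _ _), gaussianPDFReal, gaussianPDFReal,
    mul_assoc (√_)⁻¹, ← Real.exp_add]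
  congr 3
  field_simp
  ring

lemma indepGaussian_map_const_add {τ : ℝ≥0} (hτ : τ ≠ 0) (c : ι → ℝ) :
    (indepGaussian fun _ => τ).map (c + ·) = (indepGaussian fun _ => τ).withDensity fun y =>
      ENNReal.ofReal (Real.exp ((c ⬝ᵥ y - c ⬝ᵥ c / 2) / τ)) := by
  have shift : (indepGaussian fun _ => τ).map (c + ·) =
      Measure.pi fun i => gaussianReal (c i) τ := by
    have pi_map := Measure.pi_map_pi (μ := fun _ : ι => gaussianReal 0 τ)
      (f := fun i x => c i + x) fun i => by fun_prop
    simp only [gaussianReal_map_const_add, zero_add] at pi_map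
    exact pi_map
  have exponent (y : ι → ℝ) : (c ⬝ᵥ y - c ⬝ᵥ c / 2) / τ =
      ∑ i, (c i * y i - c i ^ 2 / 2) / τ := by
    simp only [dotProduct, ← Finset.sum_div, Finset.sum_sub_distrib, pow_two]
  have (i : ι) : SigmaFinite ((gaussianReal 0 τ).withDensity fun x =>
      ENNReal.ofReal (Real.exp ((c i * x - c i ^ 2 / 2) / τ))) :=
    gaussianReal_eq_withDensity_gaussianReal_zero hτ (c i) ▸ inferInstance
  rw [shift, funext fun i => gaussianReal_eq_withDensity_gaussianReal_zero hτ (c i),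
    pi_withDensity _ fun i => by fun_prop]
  congr with y
  rw [exponent, Real.exp_sum, ENNReal.ofReal_prod_of_nonneg fun i _ => (Real.exp_pos _).le]

lemma gaussianPDFReal_mul_exp {v τ : ℝ≥0} (hv : v ≠ 0) (hτ : τ ≠ 0) (t c : ℝ) :
    gaussianPDFReal 0 v c * Real.exp ((c * t - c ^ 2 / 2) / τ) =
      √(τ / (v + τ)) * Real.exp (v / (2 * τ * (v + τ)) * t ^ 2) *
        gaussianPDFReal (v * t / (v + τ)) (v * τ / (v + τ)) c := by
  have : (0 : ℝ) < v := by positivity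
  have : (0 : ℝ) < τ := by positivity
  have normalization : (√(2 * Real.pi * v))⁻¹ =
      √(τ / (v + τ)) * (√(2 * Real.pi * (v * τ / (v + τ))))⁻¹ := by
    rw [← Real.sqrt_inv, ← Real.sqrt_inv, ← Real.sqrt_mul (by positivity)]
    congr 1
    field_simp
  have complete_square : Real.exp (-(c - 0) ^ 2 / (2 * v)) *
        Real.exp ((c * t - c ^ 2 / 2) / τ) =
      Real.exp (v / (2 * τ * (v + τ)) * t ^ 2) *
        Real.exp (-(c - v * t / (v + τ)) ^ 2 / (2 * (v * τ / (v + τ)))) := by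
    rw [← Real.exp_add, ← Real.exp_add]
    congr 1
    field_simp
    ring
  rw [gaussianPDFReal, gaussianPDFReal, normalization]
  push_cast
  linear_combination √(τ / (v + τ)) * (√(2 * Real.pi * (v * τ / (v + τ))))⁻¹ * complete_square

lemma lintegral_exp_gaussianReal (v : ℝ≥0) {τ : ℝ≥0} (hτ : τ ≠ 0) (t : ℝ) :
    ∫⁻ c, ENNReal.ofReal (Real.exp ((c * t - c ^ 2 / 2) / τ)) ∂gaussianReal 0 v =
      ENNReal.ofReal (√(τ / (v + τ)) * Real.exp (v / (2 * τ * (v + τ)) * t ^ 2)) := by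
  rcases eq_or_ne v 0 with rfl | hv
  · rw [gaussianReal_zero_var, lintegral_dirac' _ (by fun_prop)]
    simp [hτ]
  rw [gaussianReal_of_var_ne_zero _ hv,
    lintegral_withDensity_eq_lintegral_mul _ (measurable_gaussianPDF _ _) (by fun_prop)]
  simp only [Pi.mul_apply, gaussianPDF]
  simp_rw [← ENNReal.ofReal_mul (gaussianPDFReal_nonneg _ _ _), gaussianPDFReal_mul_exp hv hτ,
    ENNReal.ofReal_mul (show 0 ≤ √(τ / (v + τ)) * Real.exp (v / (2 * τ * (v + τ)) * t ^ 2) by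
      positivity)]
  rw [lintegral_const_mul _ (by fun_prop), lintegral_gaussianPDFReal_eq_one _ (by positivity),
    mul_one]

end Gaussian

section Spike

variable {ι : Type*} [Fintype ι]

/-- The law of `c d + n` with independent `c ~ N(0, v)` and `n ~ N(0, τ I)`: an observation of a
single atom `d` with a random coefficient in white noise. -/
def spikeLaw (v τ : ℝ≥0) (d : ι → ℝ) : Measure (ι → ℝ) :=
  (gaussianReal 0 v).map (· • d) ∗ indepGaussian fun _ => τ

instance (v : ℝ≥0) (d : ι → ℝ) : IsProbabilityMeasure ((gaussianReal 0 v).map (· • d)) :=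
  Measure.isProbabilityMeasure_map (by fun_prop)

instance (v τ : ℝ≥0) (d : ι → ℝ) : IsProbabilityMeasure (spikeLaw v τ d) := by
  unfold spikeLaw
  infer_instance

lemma memLp_dotProduct_spikeLaw (v τ : ℝ≥0) (d w : ι → ℝ) :
    MemLp (fun y => w ⬝ᵥ y) 2 (spikeLaw v τ d) := by
  have coefficient : MemLp (fun y => w ⬝ᵥ y) 2 ((gaussianReal 0 v).map (· • d)) := by
    rw [memLp_map_measure_iff (by fun_prop) (by fun_prop)]
    simpa [Function.comp_def] using (memLp_id_gaussianReal 2).mul_const (w ⬝ᵥ d)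
  rw [spikeLaw, Measure.conv, memLp_map_measure_iff (by fun_prop) (by fun_prop)]
  simp only [Function.comp_def, dotProduct_add]
  exact (coefficient.comp_fst _).add ((memLp_dotProduct_indepGaussian _ w).comp_snd _)

lemma integral_sq_dotProduct_spikeLaw (v τ : ℝ≥0) (d w : ι → ℝ) :
    ∫ y, (w ⬝ᵥ y) ^ 2 ∂spikeLaw v τ d = v * (w ⬝ᵥ d) ^ 2 + τ * (w ⬝ᵥ w) := by
  have noise (a : ℝ) : ∫ n, (a + w ⬝ᵥ n) ^ 2 ∂indepGaussian (fun _ : ι => τ) =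
      a ^ 2 + τ * (w ⬝ᵥ w) := by
    have memLp := memLp_dotProduct_indepGaussian (fun _ : ι => τ) w
    have integrable_linear : Integrable (fun n => 2 * a * (w ⬝ᵥ n)) (indepGaussian fun _ => τ) :=
      (memLp.integrable one_le_two).const_mul _
    simp_rw [add_sq]
    rw [integral_add (f := fun n => a ^ 2 + 2 * a * (w ⬝ᵥ n))
        ((integrable_const _).add integrable_linear) memLp.integrable_sq,
      integral_add (integrable_const _) integrable_linear, integral_const_mul,
      integral_dotProduct_indepGaussian, integral_sq_dotProduct_indepGaussian]
    simp [dotProduct, Finset.mul_sum, pow_two]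
  have coefficient : ∫ c, c ^ 2 ∂gaussianReal 0 v = v := by
    rw [← variance_of_integral_eq_zero (by fun_prop) integral_id_gaussianReal,
      variance_fun_id_gaussianReal]
  have integrable_sq : Integrable (fun y => (w ⬝ᵥ y) ^ 2) (spikeLaw v τ d) :=
    (memLp_dotProduct_spikeLaw v τ d w).integrable_sq
  rw [spikeLaw, integral_conv integrable_sq]
  simp_rw [dotProduct_add, noise]
  rw [integral_map (by fun_prop) (by fun_prop)]
  simp_rw [dotProduct_smul, smul_eq_mul, mul_pow]
  have integrable_signal : Integrable (fun c => c ^ 2 * (w ⬝ᵥ d) ^ 2) (gaussianReal 0 v) :=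
    (memLp_id_gaussianReal 2).integrable_sq.mul_const _
  rw [integral_add integrable_signal (integrable_const _), integral_mul_const, coefficient]
  simp

lemma spikeLaw_eq_withDensity (v : ℝ≥0) {τ : ℝ≥0} (hτ : τ ≠ 0) {d : ι → ℝ} (hd : d ⬝ᵥ d = 1) :
    spikeLaw v τ d = (indepGaussian fun _ => τ).withDensity fun y =>
      ENNReal.ofReal (√(τ / (v + τ)) * Real.exp (v / (2 * τ * (v + τ)) * (d ⬝ᵥ y) ^ 2)) := by
  refine Measure.ext_of_lintegral _ fun f hf => ?_
  have shift (c : ℝ) : ∫⁻ y, f (c • d + y) ∂indepGaussian (fun _ : ι => τ) =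
      ∫⁻ y, ENNReal.ofReal (Real.exp ((c * (d ⬝ᵥ y) - c ^ 2 / 2) / τ)) * f y
        ∂indepGaussian (fun _ : ι => τ) := by
    rw [← lintegral_map hf (measurable_const_add (c • d)), indepGaussian_map_const_add hτ,
      lintegral_withDensity_eq_lintegral_mul _ (by fun_prop) hf]
    simp only [Pi.mul_apply, smul_dotProduct, dotProduct_smul, hd, smul_eq_mul, mul_one, pow_two]
  rw [spikeLaw, Measure.lintegral_conv hf, lintegral_map (by fun_prop) (by fun_prop),
    lintegral_congr shift, lintegral_lintegral_swap (by fun_prop),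
    lintegral_withDensity_eq_lintegral_mul _ (by fun_prop) hf]
  refine lintegral_congr fun y => ?_
  rw [lintegral_mul_const _ (by fun_prop), lintegral_exp_gaussianReal v hτ, Pi.mul_apply]

lemma spikeLaw_eq_withDensity_spikeLaw (v : ℝ≥0) {τ : ℝ≥0} (hτ : τ ≠ 0) {d d' : ι → ℝ}
    (hd : d ⬝ᵥ d = 1) (hd' : d' ⬝ᵥ d' = 1) :
    spikeLaw v τ d = (spikeLaw v τ d').withDensity fun y => ENNReal.ofReal
      (Real.exp (v / (2 * τ * (v + τ)) * ((d ⬝ᵥ y) ^ 2 - (d' ⬝ᵥ y) ^ 2))) := by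
  rw [spikeLaw_eq_withDensity v hτ hd, spikeLaw_eq_withDensity v hτ hd',
    ← withDensity_mul _ (by fun_prop) (by fun_prop)]
  congr 1
  ext y
  rw [Pi.mul_apply, ← ENNReal.ofReal_mul (by positivity), mul_assoc (√_), ← Real.exp_add]
  ring_nf

lemma klDiv_spikeLaw_le (v : ℝ≥0) {τ : ℝ≥0} (hτ : τ ≠ 0) {d d' : ι → ℝ}
    (hd : d ⬝ᵥ d = 1) (hd' : d' ⬝ᵥ d' = 1) :
    klDiv (spikeLaw v τ d) (spikeLaw v τ d') ≤
      ENNReal.ofReal ((v / τ) ^ 2 / 2 * ((d - d') ⬝ᵥ (d - d'))) := by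
  have integrable_sq (w : ι → ℝ) : Integrable (fun y => (w ⬝ᵥ y) ^ 2) (spikeLaw v τ d) :=
    (memLp_dotProduct_spikeLaw v τ d w).integrable_sq
  rw [klDiv_eq_ofReal_integral_of_withDensity_exp (by fun_prop)
    (spikeLaw_eq_withDensity_spikeLaw v hτ hd hd')
    (((integrable_sq d).sub (integrable_sq d')).const_mul _),
    integral_const_mul, integral_sub (integrable_sq d) (integrable_sq d'),
    integral_sq_dotProduct_spikeLaw, integral_sq_dotProduct_spikeLaw, hd, hd']
  refine ENNReal.ofReal_le_ofReal ?_
  have : (0 : ℝ) < τ := by positivity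
  have dist_sq : (d - d') ⬝ᵥ (d - d') = 2 * (1 - d' ⬝ᵥ d) := by
    rw [sub_dotProduct, dotProduct_sub, dotProduct_sub, hd, hd', dotProduct_comm d d']
    ring
  have inner_le_one : 0 ≤ 1 - d' ⬝ᵥ d := by
    have : 0 ≤ (d - d') ⬝ᵥ (d - d') := Finset.sum_nonneg fun i _ => mul_self_nonneg _
    linarith
  rw [dist_sq]
  calc v / (2 * τ * (v + τ)) *
        (v * 1 ^ 2 + τ * 1 - (v * (d' ⬝ᵥ d) ^ 2 + τ * 1))
      = v ^ 2 / (2 * τ * (v + τ)) * (1 - (d' ⬝ᵥ d) ^ 2) := by ring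
    _ ≤ v ^ 2 / (2 * τ * (v + τ)) * (2 * (1 - d' ⬝ᵥ d)) := by
      gcongr
      linarith [sq_nonneg (1 - d' ⬝ᵥ d)]
    _ ≤ v ^ 2 / (2 * τ * (0 + τ)) * (2 * (1 - d' ⬝ᵥ d)) := by
      gcongr
      exact v.2
    _ = (v / τ) ^ 2 / 2 * (2 * (1 - d' ⬝ᵥ d)) := by
      field_simp
      ring

end Spike

section Mixture

variable {ι κ : Type*} [Fintype ι]

@[fun_prop]
lemma measurable_mulVec (D : Matrix κ ι ℝ) : Measurable fun x : ι → ℝ => D *ᵥ x := by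
  unfold Matrix.mulVec dotProduct
  fun_prop

variable [Fintype κ]

/-- The law of `D x + n` with independent `x ~ indepGaussian V` and `n ~ N(0, τ I)`. With `V`
vanishing off a fixed support, it is the law of an observation given the support of `x`. -/
def supportObsLaw (V : ι → ℝ≥0) (τ : ℝ≥0) (D : Matrix κ ι ℝ) : Measure (κ → ℝ) :=
  (indepGaussian V).map (D *ᵥ ·) ∗ indepGaussian fun _ => τ

instance (V : ι → ℝ≥0) (τ : ℝ≥0) (D : Matrix κ ι ℝ) :
    IsProbabilityMeasure (supportObsLaw V τ D) := by
  have : IsProbabilityMeasure ((indepGaussian V).map (D *ᵥ ·)) :=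
    Measure.isProbabilityMeasure_map (by fun_prop)
  unfold supportObsLaw
  infer_instance

lemma supportObsLaw_eq_conv_spikeLaw [DecidableEq ι] (V : ι → ℝ≥0) (τ : ℝ≥0) (D : Matrix κ ι ℝ)
    (k : ι) :
    supportObsLaw V τ D =
      (indepGaussian V).map (∑ i ∈ Finset.univ.erase k, fun x => x i • Dᵀ i) ∗
        spikeLaw (V k) τ (Dᵀ k) := by
  have indep : iIndepFun (fun i (x : ι → ℝ) => x i • Dᵀ i) (indepGaussian V) :=
    iIndepFun_pi (X := fun i t => t • Dᵀ i) fun i => by fun_prop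
  have split : (D *ᵥ ·) =
      (∑ i ∈ Finset.univ.erase k, fun x : ι → ℝ => x i • Dᵀ i) + fun x => x k • Dᵀ k := by
    ext1 x
    rw [Finset.sum_erase_add _ _ (Finset.mem_univ k), Finset.sum_apply, Matrix.mulVec_eq_sum]
    simp only [op_smul_eq_smul]
  have atom : (indepGaussian V).map (fun x => x k • Dᵀ k) =
      (gaussianReal 0 (V k)).map (· • Dᵀ k) := by
    rw [← (measurePreserving_eval (fun i => gaussianReal 0 (V i)) k).map_eq,
      Measure.map_map (by fun_prop) (by fun_prop)]
    rfl
  rw [supportObsLaw, split, (indep.indepFun_finsetSum_of_notMem (fun i => by fun_prop)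
    (Finset.notMem_erase k _)).map_add_eq_map_conv_map (by fun_prop) (by fun_prop), atom,
    Measure.conv_assoc, spikeLaw]

lemma klDiv_supportObsLaw_le (V : ι → ℝ≥0) {τ : ℝ≥0} (hτ : τ ≠ 0) {D D' : Matrix κ ι ℝ} {k : ι}
    (hDD' : ∀ i ≠ k, Dᵀ i = D'ᵀ i) (hk : Dᵀ k ⬝ᵥ Dᵀ k = 1) (hk' : D'ᵀ k ⬝ᵥ D'ᵀ k = 1) :
    klDiv (supportObsLaw V τ D) (supportObsLaw V τ D') ≤
      ENNReal.ofReal ((V k / τ) ^ 2 / 2 * ((Dᵀ k - D'ᵀ k) ⬝ᵥ (Dᵀ k - D'ᵀ k))) := by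
  classical
  have other_atoms : (∑ i ∈ Finset.univ.erase k, fun x : ι → ℝ => x i • Dᵀ i) =
      ∑ i ∈ Finset.univ.erase k, fun x => x i • D'ᵀ i :=
    Finset.sum_congr rfl fun i hi => by rw [hDD' i (Finset.ne_of_mem_erase hi)]
  have : IsProbabilityMeasure
      ((indepGaussian V).map (∑ i ∈ Finset.univ.erase k, fun x => x i • D'ᵀ i)) :=
    Measure.isProbabilityMeasure_map (by fun_prop)
  rw [supportObsLaw_eq_conv_spikeLaw V τ D k, supportObsLaw_eq_conv_spikeLaw V τ D' k, other_atoms]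
  exact (klDiv_conv_left_le _ _ _).trans (klDiv_spikeLaw_le _ hτ hk hk')

lemma indepGaussian_map_comp {e : κ → ι} (he : e.Injective) (V : ι → ℝ≥0) :
    (indepGaussian V).map (· ∘ e) = indepGaussian (V ∘ e) := by
  have infinitePi_map := Measure.map_infinitePi_infinitePi_of_inj
    (P := fun i => gaussianReal 0 (V i)) he
  simp only [Measure.infinitePi_eq_pi] at infinitePi_map
  exact infinitePi_map

lemma card_nsmul_sum_perm_apply {M : Type*} [AddCommMonoid M] [DecidableEq ι] (f : ι → M) (k : ι) :
    Fintype.card ι • ∑ π : Equiv.Perm ι, f (π k) = (Fintype.card ι)! • ∑ i, f i := by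
  have same_sum (l : ι) : ∑ π : Equiv.Perm ι, f (π l) = ∑ π : Equiv.Perm ι, f (π k) :=
    Fintype.sum_equiv (Equiv.mulRight (Equiv.swap k l)) _ _ fun π => by simp
  calc Fintype.card ι • ∑ π : Equiv.Perm ι, f (π k)
      = ∑ l, ∑ π : Equiv.Perm ι, f (π l) := by simp [same_sum]
    _ = ∑ π : Equiv.Perm ι, ∑ l, f (π l) := Finset.sum_comm
    _ = (Fintype.card ι)! • ∑ i, f i := by simp [Equiv.sum_comp, Fintype.card_perm]

end Mixture

section Model

variable {m p s : ℕ}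

/-- The variances of the entries of `x = P (zᵀ, 0)ᵀ` given that `P` is the matrix of `π`: the
support of `x` is `{i | π i < s}`. -/
def coeffVariance (s : ℕ) (σa : ℝ) (π : Equiv.Perm (Fin p)) (i : Fin p) : ℝ≥0 :=
  if (π i : ℕ) < s then (σa ^ 2).toNNReal else 0

lemma sum_apply_coeffVariance {M : Type*} [AddCommMonoid M] (hsp : s ≤ p) (σa : ℝ) {f : ℝ≥0 → M}
    (hf : f 0 = 0) (π : Equiv.Perm (Fin p)) :
    ∑ i, f (coeffVariance s σa π i) = s • f (σa ^ 2).toNNReal := by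
  simp only [coeffVariance, apply_ite f, hf]
  rw [Equiv.sum_comp π fun i => if (i : ℕ) < s then f (σa ^ 2).toNNReal else 0,
    ← Finset.sum_filter, Finset.sum_const, Fin.card_filter_val_lt, min_eq_right hsp]

lemma iidGaussian_map_permMatrix_mulVec_zeroPad (hsp : s ≤ p) (σa : ℝ) (π : Equiv.Perm (Fin p)) :
    (iidGaussian s σa).map (fun z => π.permMatrix ℝ *ᵥ zeroPad p z) =
      indepGaussian (coeffVariance s σa π) := by
  set V := coeffVariance s σa π with hV
  have project : iidGaussian s σa = (indepGaussian V).map (· ∘ (π.symm ∘ Fin.castLE hsp)) := by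
    rw [indepGaussian_map_comp (π.symm.injective.comp (Fin.castLE_injective hsp))]
    simp [hV, iidGaussian, coeffVariance, Function.comp_def]
  have measurable_coeff : Measurable fun z : Fin s → ℝ => π.permMatrix ℝ *ᵥ zeroPad p z := by
    refine (measurable_mulVec _).comp (measurable_pi_iff.2 fun i => ?_)
    by_cases hi : (i : ℕ) < s <;> simp only [zeroPad, hi, ↓reduceDIte] <;> fun_prop
  have mask : (fun x : Fin p → ℝ =>
        π.permMatrix ℝ *ᵥ zeroPad p (x ∘ (π.symm ∘ Fin.castLE hsp))) =
      fun x i => if (π i : ℕ) < s then x i else 0 := by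
    ext x i
    simp [Matrix.permMatrix_mulVec, zeroPad]
  have mask_law (i : Fin p) : (gaussianReal 0 (V i)).map
      (fun t => if (π i : ℕ) < s then t else 0) = gaussianReal 0 (V i) := by
    by_cases hi : (π i : ℕ) < s <;> simp [hV, coeffVariance, hi]
  rw [project, Measure.map_map measurable_coeff (by fun_prop), Function.comp_def, mask,
    Measure.pi_map_pi (f := fun i t => if (π i : ℕ) < s then t else 0)
      fun i => (Measurable.ite (.const _) measurable_id measurable_const).aemeasurable]
  simp only [mask_law]

lemma coeffLaw_eq (hsp : s ≤ p) (σa : ℝ) :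
    coeffLaw p s σa = (p ! : ℝ≥0∞)⁻¹ • ∑ π, indepGaussian (coeffVariance s σa π) := by
  simp only [coeffLaw, iidGaussian_map_permMatrix_mulVec_zeroPad hsp]

lemma obsLaw_eq (hsp : s ≤ p) (σa σ : ℝ) (D : Matrix (Fin m) (Fin p) ℝ) :
    obsLaw s σa σ D =
      (p ! : ℝ≥0∞)⁻¹ • ∑ π, supportObsLaw (coeffVariance s σa π) (σ ^ 2).toNNReal D := by
  refine Measure.ext_of_lintegral _ fun f hf => ?_
  have : IsProbabilityMeasure (iidGaussian m σ) := by unfold iidGaussian; infer_instance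
  have conditional (V : Fin p → ℝ≥0) : ∫⁻ y, f y ∂supportObsLaw V (σ ^ 2).toNNReal D =
      ∫⁻ x, ∫⁻ n, f (D *ᵥ x + n) ∂iidGaussian m σ ∂indepGaussian V := by
    rw [supportObsLaw, Measure.lintegral_conv hf, lintegral_map (by fun_prop) (by fun_prop)]
    rfl
  rw [obsLaw, coeffLaw_eq hsp, lintegral_map hf (by fun_prop), lintegral_prod _ (by fun_prop)]
  simp only [lintegral_smul_measure, lintegral_finsetSum_measure, conditional]

lemma isProbabilityMeasure_obsLaw (hsp : s ≤ p) (σa σ : ℝ) (D : Matrix (Fin m) (Fin p) ℝ) :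
    IsProbabilityMeasure (obsLaw s σa σ D) := by
  constructor
  have : (p ! : ℝ≥0∞) ≠ 0 := by exact_mod_cast p.factorial_ne_zero
  rw [obsLaw_eq hsp]
  simp [Fintype.card_perm, ENNReal.inv_mul_cancel this (ENNReal.natCast_ne_top _)]

lemma mul_klDiv_obsLaw_le (hsp : s ≤ p) (σa : ℝ) {σ : ℝ} (hσ : σ ≠ 0)
    {D D' : Matrix (Fin m) (Fin p) ℝ} {k : Fin p} (hDD' : ∀ i ≠ k, Dᵀ i = D'ᵀ i)
    (hD : D ∈ obliqueManifold m p) (hD' : D' ∈ obliqueManifold m p) :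
    p * klDiv (obsLaw s σa σ D) (obsLaw s σa σ D') ≤
      s * ENNReal.ofReal ((σa ^ 2 / σ ^ 2) ^ 2 / 2 * ((Dᵀ k - D'ᵀ k) ⬝ᵥ (Dᵀ k - D'ᵀ k))) := by
  set δ := (Dᵀ k - D'ᵀ k) ⬝ᵥ (Dᵀ k - D'ᵀ k)
  set τ := (σ ^ 2).toNNReal
  have hτ : τ ≠ 0 := by simpa [τ] using hσ
  let g (v : ℝ≥0) : ℝ≥0∞ := ENNReal.ofReal ((v / τ) ^ 2 / 2 * δ)
  have factorial_ne_zero : (p ! : ℝ≥0) ≠ 0 := by exact_mod_cast p.factorial_ne_zero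
  have convexity : klDiv (obsLaw s σa σ D) (obsLaw s σa σ D') ≤
      (p ! : ℝ≥0∞)⁻¹ * ∑ π : Equiv.Perm (Fin p), g (coeffVariance s σa π k) := by
    have weight : (p ! : ℝ≥0∞)⁻¹ = ((p ! : ℝ≥0)⁻¹ : ℝ≥0) := by
      rw [ENNReal.coe_inv factorial_ne_zero, ENNReal.coe_natCast]
    simp only [obsLaw_eq hsp, weight]
    rw [← ENNReal.smul_def, ← ENNReal.smul_def, klDiv_smul_same]
    gcongr
    refine (klDiv_finsetSum_le _ _ _).trans (Finset.sum_le_sum fun π _ => ?_)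
    exact klDiv_supportObsLaw_le _ hτ hDD' (hD k) (hD' k)
  have support_average : p • ∑ π : Equiv.Perm (Fin p), g (coeffVariance s σa π k) =
      p ! • s • g (σa ^ 2).toNNReal := by
    rw [← sum_apply_coeffVariance hsp σa (by simp [g]) 1]
    simpa using! card_nsmul_sum_perm_apply (fun i => g (coeffVariance s σa 1 i)) k
  calc p * klDiv (obsLaw s σa σ D) (obsLaw s σa σ D')
      ≤ p * ((p ! : ℝ≥0∞)⁻¹ * ∑ π : Equiv.Perm (Fin p), g (coeffVariance s σa π k)) := by gcongr
    _ = (p ! : ℝ≥0∞)⁻¹ * (p • ∑ π : Equiv.Perm (Fin p), g (coeffVariance s σa π k)) := by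
      rw [nsmul_eq_mul, mul_left_comm]
    _ = s * g (σa ^ 2).toNNReal := by
      rw [support_average, nsmul_eq_mul, nsmul_eq_mul, ENNReal.inv_mul_cancel_left
        (by exact_mod_cast p.factorial_ne_zero) (ENNReal.natCast_ne_top _)]
    _ = s * ENNReal.ofReal ((σa ^ 2 / σ ^ 2) ^ 2 / 2 * δ) := by
      simp only [g, τ, Real.coe_toNNReal _ (sq_nonneg _)]

lemma mul_klDiv_dataLaw_le (N : ℕ) (hsp : s ≤ p) (σa : ℝ) {σ : ℝ} (hσ : σ ≠ 0)
    {D D' : Matrix (Fin m) (Fin p) ℝ} {k : Fin p} (hDD' : ∀ i ≠ k, Dᵀ i = D'ᵀ i)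
    (hD : D ∈ obliqueManifold m p) (hD' : D' ∈ obliqueManifold m p) :
    p * klDiv (dataLaw N s σa σ D) (dataLaw N s σa σ D') ≤
      ENNReal.ofReal
        (N * s * ((σa ^ 2 / σ ^ 2) ^ 2 / 2 * ((Dᵀ k - D'ᵀ k) ⬝ᵥ (Dᵀ k - D'ᵀ k)))) := by
  have := isProbabilityMeasure_obsLaw hsp σa σ D
  have := isProbabilityMeasure_obsLaw hsp σa σ D'
  calc p * klDiv (dataLaw N s σa σ D) (dataLaw N s σa σ D')
      ≤ p * (N * klDiv (obsLaw s σa σ D) (obsLaw s σa σ D')) :=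
        mul_le_mul_right (klDiv_pi_const_le N _ _) _
    _ = N * (p * klDiv (obsLaw s σa σ D) (obsLaw s σa σ D')) := mul_left_comm _ _ _
    _ ≤ N * (s * ENNReal.ofReal
        ((σa ^ 2 / σ ^ 2) ^ 2 / 2 * ((Dᵀ k - D'ᵀ k) ⬝ᵥ (Dᵀ k - D'ᵀ k)))) :=
      mul_le_mul_right (mul_klDiv_obsLaw_le hsp σa hσ hDD' hD hD') _
    _ = _ := by
      rw [mul_assoc (N : ℝ), ENNReal.ofReal_mul N.cast_nonneg, ENNReal.ofReal_mul s.cast_nonneg,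
        ENNReal.ofReal_natCast, ENNReal.ofReal_natCast]

lemma euclNorm_sq {n : ℕ} (v : Fin n → ℝ) : euclNorm v ^ 2 = v ⬝ᵥ v := by
  rw [euclNorm, EuclideanSpace.real_norm_sq_eq]
  simp [dotProduct, pow_two]

lemma euclNorm_mulVec_sq (D : Matrix (Fin m) (Fin p) ℝ) (x : Fin p → ℝ) :
    euclNorm (D *ᵥ x) ^ 2 = ∑ j, (D j ⬝ᵥ x) ^ 2 := by
  rw [euclNorm_sq, dotProduct]
  simp only [pow_two, Matrix.mulVec]

lemma integrable_euclNorm_mulVec_sq (V : Fin p → ℝ≥0) (D : Matrix (Fin m) (Fin p) ℝ) :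
    Integrable (fun x => euclNorm (D *ᵥ x) ^ 2) (indepGaussian V) := by
  simp only [euclNorm_mulVec_sq]
  exact integrable_finsetSum _ fun j _ => (memLp_dotProduct_indepGaussian V (D j)).integrable_sq

lemma integral_euclNorm_mulVec_sq (V : Fin p → ℝ≥0) {D : Matrix (Fin m) (Fin p) ℝ}
    (hD : D ∈ obliqueManifold m p) :
    ∫ x, euclNorm (D *ᵥ x) ^ 2 ∂indepGaussian V = ∑ i, (V i : ℝ) := by
  have unit_columns (i : Fin p) : ∑ j, D j i ^ 2 = 1 := by
    simpa [pow_two, Matrix.mul_apply] using hD i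
  simp only [euclNorm_mulVec_sq]
  rw [integral_finsetSum _ fun j _ => (memLp_dotProduct_indepGaussian V (D j)).integrable_sq]
  simp only [integral_sq_dotProduct_indepGaussian]
  rw [Finset.sum_comm]
  simp only [← Finset.mul_sum, unit_columns, mul_one]

lemma SNR_eq (hsp : s ≤ p) (σa σ : ℝ) {D : Matrix (Fin m) (Fin p) ℝ}
    (hD : D ∈ obliqueManifold m p) : SNR s σa σ D = s * σa ^ 2 / (m * σ ^ 2) := by
  have factorial_ne_zero : (p ! : ℝ) ≠ 0 := by exact_mod_cast p.factorial_ne_zero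
  have signal : ∫ x, euclNorm (D *ᵥ x) ^ 2 ∂coeffLaw p s σa = s * σa ^ 2 := by
    rw [coeffLaw_eq hsp, integral_smul_measure,
      integral_finsetSum_measure fun π _ => integrable_euclNorm_mulVec_sq _ D]
    simp [integral_euclNorm_mulVec_sq _ hD, sum_apply_coeffVariance hsp σa NNReal.coe_zero,
      Fintype.card_perm, factorial_ne_zero, sq_nonneg]
  have noise : ∫ n, euclNorm n ^ 2 ∂iidGaussian m σ = m * σ ^ 2 := by
    have one_mem : (1 : Matrix (Fin m) (Fin m) ℝ) ∈ obliqueManifold m m := fun k => by simp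
    have := integral_euclNorm_mulVec_sq (fun _ => (σ ^ 2).toNNReal) one_mem
    simpa [sq_nonneg, iidGaussian] using this
  rw [SNR, signal, noise]

end Model

section Sphere

variable {ι J : Type*} [Fintype ι] [Fintype J]

/-- The point of the unit sphere above the tangent vector `w ᵥ* U` at the unit vector `d`, for a
matrix `U` whose rows are orthonormal and orthogonal to `d`. It is meant for `w ⬝ᵥ w ≤ 1`. -/
def sphereChart (d : ι → ℝ) (U : Matrix J ι ℝ) (w : J → ℝ) : ι → ℝ :=
  √(1 - w ⬝ᵥ w) • d + w ᵥ* U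

lemma exists_orthonormal_rows {q : ℕ} (hq : Fintype.card ι = q + 1) {d : ι → ℝ}
    (hd : d ⬝ᵥ d = 1) : ∃ U : Matrix (Fin q) ι ℝ, U * Uᵀ = 1 ∧ U *ᵥ d = 0 := by
  have inner_eq (x y : EuclideanSpace ℝ ι) : inner ℝ x y = x.ofLp ⬝ᵥ y.ofLp := by
    rw [EuclideanSpace.inner_eq_star_dotProduct, dotProduct_comm, star_trivial]
  have hd₀ : WithLp.toLp 2 d ≠ 0 := by
    intro h
    simp [(WithLp.toLp_eq_zero 2).1 h] at hd
  have : Fact (Module.finrank ℝ (EuclideanSpace ℝ ι) = q + 1) :=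
    ⟨finrank_euclideanSpace.trans hq⟩
  set B := OrthonormalBasis.fromOrthogonalSpanSingleton (𝕜 := ℝ) q hd₀
  have hB : Orthonormal ℝ fun i => (B i : EuclideanSpace ℝ ι) :=
    B.orthonormal.comp_linearIsometry (Submodule.subtypeₗᵢ _)
  refine ⟨Matrix.of fun i => (B i : EuclideanSpace ℝ ι).ofLp, ?_, ?_⟩
  · ext i j
    rw [Matrix.one_apply, ← orthonormal_iff_ite.1 hB i j, inner_eq]
    rfl
  · ext i
    exact (inner_eq _ _).symm.trans
      (Submodule.mem_orthogonal_singleton_iff_inner_left.1 (B i).2)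

variable [DecidableEq J] {U : Matrix J ι ℝ} (hU : U * Uᵀ = 1)
include hU

lemma mulVec_vecMul_of_mul_transpose_eq_one (w : J → ℝ) : U *ᵥ (w ᵥ* U) = w := by
  rw [← Matrix.mulVec_transpose, Matrix.mulVec_mulVec, hU, Matrix.one_mulVec]

lemma vecMul_dotProduct_vecMul (w w' : J → ℝ) : (w ᵥ* U) ⬝ᵥ (w' ᵥ* U) = w ⬝ᵥ w' := by
  rw [← Matrix.dotProduct_mulVec, mulVec_vecMul_of_mul_transpose_eq_one hU]

lemma mulVec_dotProduct_mulVec_le (v : ι → ℝ) : (U *ᵥ v) ⬝ᵥ (U *ᵥ v) ≤ v ⬝ᵥ v := by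
  have residual_nonneg := dotProduct_self_star_nonneg (v - (U *ᵥ v) ᵥ* U)
  have cross : ((U *ᵥ v) ᵥ* U) ⬝ᵥ v = (U *ᵥ v) ⬝ᵥ (U *ᵥ v) :=
    (Matrix.dotProduct_mulVec _ U v).symm
  rw [star_trivial, sub_dotProduct, dotProduct_sub, dotProduct_sub,
    vecMul_dotProduct_vecMul hU, dotProduct_comm v (_ ᵥ* U), cross] at residual_nonneg
  linarith

lemma sphereChart_sub_sphereChart_dotProduct_self (d : ι → ℝ) {w w' : J → ℝ}
    (hww' : w ⬝ᵥ w = w' ⬝ᵥ w') :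
    (sphereChart d U w - sphereChart d U w') ⬝ᵥ (sphereChart d U w - sphereChart d U w') =
      (w - w') ⬝ᵥ (w - w') := by
  rw [sphereChart, sphereChart, hww', add_sub_add_left_eq_sub, ← Matrix.sub_vecMul,
    vecMul_dotProduct_vecMul hU]

variable {d : ι → ℝ} (hUd : U *ᵥ d = 0)
include hUd

lemma mulVec_sphereChart (w : J → ℝ) : U *ᵥ sphereChart d U w = w := by
  rw [sphereChart, Matrix.mulVec_add, Matrix.mulVec_smul, hUd, smul_zero, zero_add,
    mulVec_vecMul_of_mul_transpose_eq_one hU]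

lemma smul_add_vecMul_dotProduct_self (hd : d ⬝ᵥ d = 1) (c : ℝ) (w : J → ℝ) :
    (c • d + w ᵥ* U) ⬝ᵥ (c • d + w ᵥ* U) = c ^ 2 + w ⬝ᵥ w := by
  have cross : (w ᵥ* U) ⬝ᵥ d = 0 := by rw [← Matrix.dotProduct_mulVec, hUd, dotProduct_zero]
  rw [add_dotProduct, dotProduct_add, dotProduct_add, vecMul_dotProduct_vecMul hU,
    smul_dotProduct, smul_dotProduct, dotProduct_smul, dotProduct_smul,
    dotProduct_comm d (w ᵥ* U), cross, hd]
  simp only [smul_eq_mul]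
  ring

variable {w : J → ℝ} (hw : w ⬝ᵥ w ≤ 1)
include hw

lemma sphereChart_dotProduct_self (hd : d ⬝ᵥ d = 1) :
    sphereChart d U w ⬝ᵥ sphereChart d U w = 1 := by
  rw [sphereChart, smul_add_vecMul_dotProduct_self hU hUd hd, Real.sq_sqrt (sub_nonneg.2 hw)]
  ring

lemma sphereChart_sub_dotProduct_self_le (hd : d ⬝ᵥ d = 1) :
    (sphereChart d U w - d) ⬝ᵥ (sphereChart d U w - d) ≤ 2 * (w ⬝ᵥ w) := by
  have split : sphereChart d U w - d = (√(1 - w ⬝ᵥ w) - 1) • d + w ᵥ* U := by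
    rw [sphereChart, sub_smul, one_smul]
    abel
  have le_sqrt : 1 - w ⬝ᵥ w ≤ √(1 - w ⬝ᵥ w) :=
    Real.le_sqrt_self_iff.2 (sub_le_self _ (dotProduct_self_star_nonneg w))
  rw [split, smul_add_vecMul_dotProduct_self hU hUd hd, sub_sq, Real.sq_sqrt (sub_nonneg.2 hw)]
  linarith

end Sphere

section Dictionary

variable {m p : ℕ}

lemma frobNorm_sq (A : Matrix (Fin m) (Fin p) ℝ) : frobNorm A ^ 2 = ∑ k, Aᵀ k ⬝ᵥ Aᵀ k := by
  have trace_eq : (A * Aᵀ).trace = ∑ k, Aᵀ k ⬝ᵥ Aᵀ k := by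
    rw [Matrix.trace_mul_comm]
    rfl
  rw [frobNorm, trace_eq]
  exact Real.sq_sqrt (Finset.sum_nonneg fun k _ => dotProduct_self_star_nonneg (Aᵀ k))

lemma pos_of_mem_obliqueManifold (hp : 0 < p) {D : Matrix (Fin m) (Fin p) ℝ}
    (hD : D ∈ obliqueManifold m p) : 0 < m := by
  refine Nat.pos_of_ne_zero ?_
  rintro rfl
  simpa [Matrix.mul_apply] using hD ⟨0, hp⟩

variable {J : Type*} [Fintype J]

/-- The dictionary near `D₀` whose atoms have the coordinates `w k` in the sphere charts at the
atoms of `D₀` given by the matrices `U k`. -/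
def perturbedDict (D₀ : Matrix (Fin m) (Fin p) ℝ) (U : Fin p → Matrix J (Fin m) ℝ)
    (w : Fin p → J → ℝ) : Matrix (Fin m) (Fin p) ℝ :=
  (Matrix.of fun k => sphereChart (D₀ᵀ k) (U k) (w k))ᵀ

variable [DecidableEq J] {D₀ : Matrix (Fin m) (Fin p) ℝ} (hD₀ : D₀ ∈ obliqueManifold m p)
  {U : Fin p → Matrix J (Fin m) ℝ} (hU : ∀ k, U k * (U k)ᵀ = 1) (hUD₀ : ∀ k, U k *ᵥ D₀ᵀ k = 0)
include hU hUD₀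

lemma sum_mulVec_sub_dotProduct_self_le (A : Matrix (Fin m) (Fin p) ℝ) (w : Fin p → J → ℝ) :
    ∑ k, (U k *ᵥ Aᵀ k - w k) ⬝ᵥ (U k *ᵥ Aᵀ k - w k) ≤
      frobNorm (A - perturbedDict D₀ U w) ^ 2 := by
  rw [frobNorm_sq]
  refine Finset.sum_le_sum fun k _ => ?_
  have decode : U k *ᵥ Aᵀ k - w k = U k *ᵥ (A - perturbedDict D₀ U w)ᵀ k := by
    calc U k *ᵥ Aᵀ k - w k = U k *ᵥ Aᵀ k - U k *ᵥ sphereChart (D₀ᵀ k) (U k) (w k) := by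
          rw [mulVec_sphereChart (hU k) (hUD₀ k)]
      _ = U k *ᵥ (A - perturbedDict D₀ U w)ᵀ k := (Matrix.mulVec_sub _ _ _).symm
  rw [decode]
  exact mulVec_dotProduct_mulVec_le (hU k) _

variable {w : Fin p → J → ℝ} (hw : ∀ k, w k ⬝ᵥ w k ≤ 1)
include hD₀ hw

lemma perturbedDict_mem_obliqueManifold : perturbedDict D₀ U w ∈ obliqueManifold m p :=
  fun k => sphereChart_dotProduct_self (hU k) (hUD₀ k) (hw k) (hD₀ k)

lemma frobNorm_perturbedDict_sub_sq_le :
    frobNorm (perturbedDict D₀ U w - D₀) ^ 2 ≤ 2 * ∑ k, w k ⬝ᵥ w k := by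
  rw [frobNorm_sq, Finset.mul_sum]
  exact Finset.sum_le_sum fun k _ =>
    sphereChart_sub_dotProduct_self_le (hU k) (hUD₀ k) (hw k) (hD₀ k)

end Dictionary

section Cube

variable {ι J : Type*}

/-- The vertex `b ε` of the cube `[-b, b] ^ (ι × J)`, curried so as to serve as a family of
coordinate vectors in `perturbedDict`. -/
def cubeVertex (b : ℝ) (ε : ι × J → ℤˣ) (i : ι) (j : J) : ℝ :=
  b * (ε (i, j) : ℤ)

lemma cubeVertex_dotProduct_self [Fintype J] (b : ℝ) (ε : ι × J → ℤˣ) (i : ι) :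
    cubeVertex b ε i ⬝ᵥ cubeVertex b ε i = Fintype.card J * b ^ 2 := by
  simp only [dotProduct, cubeVertex, ← pow_two, mul_pow, sq_intCast_sign, mul_one,
    Finset.sum_const, Finset.card_univ, nsmul_eq_mul]

variable [DecidableEq ι] [DecidableEq J]

lemma cubeVertex_flipSign_of_ne (b : ℝ) (ε : ι × J → ℤˣ) {i k : ι} (hik : i ≠ k) (j : J) :
    cubeVertex b (flipSign (k, j) ε) i = cubeVertex b ε i := by
  ext l
  rw [cubeVertex, flipSign, Function.update_of_ne (by simp [hik]), cubeVertex]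

lemma cubeVertex_sub_cubeVertex_flipSign (b : ℝ) (ε : ι × J → ℤˣ) (k : ι) (j : J) :
    cubeVertex b ε k - cubeVertex b (flipSign (k, j) ε) k =
      Pi.single j (2 * b * (ε (k, j) : ℤ)) := by
  ext l
  rcases eq_or_ne l j with rfl | hlj
  · simp only [Pi.sub_apply, cubeVertex, flipSign, Function.update_self, Units.val_neg,
      Int.cast_neg, Pi.single_eq_same]
    ring
  · simp [cubeVertex, flipSign, hlj]

end Cube

section Risk

variable {m p s : ℕ} {J : Type*} [Fintype J] [DecidableEq J] (hsp : s ≤ p)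
  {σa σ : ℝ} {D₀ : Matrix (Fin m) (Fin p) ℝ} (hD₀ : D₀ ∈ obliqueManifold m p)
  {U : Fin p → Matrix J (Fin m) ℝ} (hU : ∀ k, U k * (U k)ᵀ = 1) (hUD₀ : ∀ k, U k *ᵥ D₀ᵀ k = 0)
  {b : ℝ} (hb : Fintype.card J * b ^ 2 ≤ 1)

include hD₀ hU hUD₀ hb

lemma perturbedDict_cubeVertex_mem_obliqueManifold (ε : Fin p × J → ℤˣ) :
    perturbedDict D₀ U (cubeVertex b ε) ∈ obliqueManifold m p :=
  perturbedDict_mem_obliqueManifold hD₀ hU hUD₀ fun k =>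
    (cubeVertex_dotProduct_self b ε k).trans_le hb

lemma perturbedDict_cubeVertex_mem_neighborhood {r : ℝ} (hr : 0 < r)
    (hbr : 2 * (p * (Fintype.card J * b ^ 2)) < r ^ 2) (ε : Fin p × J → ℤˣ) :
    perturbedDict D₀ U (cubeVertex b ε) ∈ neighborhood D₀ r := by
  refine ⟨perturbedDict_cubeVertex_mem_obliqueManifold hD₀ hU hUD₀ hb ε,
    lt_of_pow_lt_pow_left₀ 2 hr.le ((frobNorm_perturbedDict_sub_sq_le hD₀ hU hUD₀ fun k =>
      (cubeVertex_dotProduct_self b ε k).trans_le hb).trans_lt ?_)⟩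
  simpa only [cubeVertex_dotProduct_self, Finset.sum_const, Finset.card_univ, Fintype.card_fin,
    nsmul_eq_mul] using hbr

include hsp

lemma klDiv_dataLaw_perturbedDict_flipSign_le {N : ℕ} (hσ : σ ≠ 0)
    (hbN : 4 * (N * s * (σa ^ 2 / σ ^ 2) ^ 2 * b ^ 2) ≤ p) (l : Fin p × J)
    (ε : Fin p × J → ℤˣ) :
    klDiv (dataLaw N s σa σ (perturbedDict D₀ U (cubeVertex b ε)))
      (dataLaw N s σa σ (perturbedDict D₀ U (cubeVertex b (flipSign l ε)))) ≤ 2⁻¹ := by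
  obtain ⟨k, j⟩ := l
  set D := perturbedDict D₀ U (cubeVertex b ε)
  set D' := perturbedDict D₀ U (cubeVertex b (flipSign (k, j) ε))
  have other_atoms : ∀ i ≠ k, Dᵀ i = D'ᵀ i := fun i hik =>
    congrArg (sphereChart (D₀ᵀ i) (U i)) (cubeVertex_flipSign_of_ne b ε hik j).symm
  have atom_gap : (Dᵀ k - D'ᵀ k) ⬝ᵥ (Dᵀ k - D'ᵀ k) = 4 * b ^ 2 := by
    refine (sphereChart_sub_sphereChart_dotProduct_self (hU k) _ ?_).trans ?_
    · rw [cubeVertex_dotProduct_self, cubeVertex_dotProduct_self]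
    · rw [cubeVertex_sub_cubeVertex_flipSign, single_dotProduct, Pi.single_eq_same]
      linear_combination 4 * b ^ 2 * sq_intCast_sign (ε (k, j))
  have hp : (p : ℝ≥0∞) ≠ 0 := Nat.cast_ne_zero.2 k.pos.ne'
  refine (ENNReal.mul_le_mul_iff_right hp (ENNReal.natCast_ne_top p)).1 ?_
  calc p * klDiv (dataLaw N s σa σ D) (dataLaw N s σa σ D')
      ≤ ENNReal.ofReal (N * s * ((σa ^ 2 / σ ^ 2) ^ 2 / 2 * (4 * b ^ 2))) := by
        rw [← atom_gap]
        exact mul_klDiv_dataLaw_le N hsp σa hσ other_atoms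
          (perturbedDict_cubeVertex_mem_obliqueManifold hD₀ hU hUD₀ hb _)
          (perturbedDict_cubeVertex_mem_obliqueManifold hD₀ hU hUD₀ hb _)
    _ ≤ ENNReal.ofReal (p * 2⁻¹) := ENNReal.ofReal_le_ofReal (by linarith)
    _ = p * 2⁻¹ := by
        rw [ENNReal.ofReal_mul p.cast_nonneg, ENNReal.ofReal_natCast,
          ENNReal.ofReal_inv_of_pos two_pos, ENNReal.ofReal_ofNat]

theorem ofReal_le_minimaxRisk {N : ℕ} (hσ : σ ≠ 0) {r : ℝ} (hr : 0 < r)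
    (hbr : 2 * (p * (Fintype.card J * b ^ 2)) < r ^ 2)
    (hbN : 4 * (N * s * (σa ^ 2 / σ ^ 2) ^ 2 * b ^ 2) ≤ p) :
    ENNReal.ofReal (p * (Fintype.card J * b ^ 2) / 2) ≤ minimaxRisk N s σa σ D₀ r := by
  set E := fun ε : Fin p × J → ℤˣ => perturbedDict D₀ U (cubeVertex b ε)
  have (ε : Fin p × J → ℤˣ) : IsProbabilityMeasure (dataLaw N s σa σ (E ε)) := by
    have := isProbabilityMeasure_obsLaw hsp σa σ (E ε)
    unfold dataLaw
    infer_instance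
  refine le_iInf fun ⟨est, measurable_est⟩ => ?_
  have measurable_decode (l : Fin p × J) : Measurable fun Y => (U l.1 *ᵥ (est Y)ᵀ l.1) l.2 := by
    simp only [Matrix.mulVec, dotProduct, Matrix.transpose_apply]
    fun_prop
  calc ENNReal.ofReal (p * (Fintype.card J * b ^ 2) / 2)
      = ENNReal.ofReal (Fintype.card (Fin p × J) * b ^ 2 / 2) := by
        rw [Fintype.card_prod, Fintype.card_fin, Nat.cast_mul, mul_assoc]
    _ ≤ ⨆ ε, ∫⁻ Y, ENNReal.ofReal (∑ l : Fin p × J,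
          ((U l.1 *ᵥ (est Y)ᵀ l.1) l.2 - b * (ε l : ℤ)) ^ 2) ∂dataLaw N s σa σ (E ε) :=
        assouad _ (klDiv_dataLaw_perturbedDict_flipSign_le hsp hD₀ hU hUD₀ hb hσ hbN)
          measurable_decode b
    _ ≤ ⨆ ε, mse N s σa σ est (E ε) := by
        refine iSup_mono fun ε => lintegral_mono fun Y => ENNReal.ofReal_le_ofReal ?_
        simpa only [Fintype.sum_prod_type, dotProduct, ← pow_two, Pi.sub_apply, cubeVertex] using
          sum_mulVec_sub_dotProduct_self_le hU hUD₀ (est Y) (cubeVertex b ε)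
    _ ≤ ⨆ D ∈ neighborhood D₀ r, mse N s σa σ est D :=
        iSup_le fun ε => le_iSup₂_of_le (E ε)
          (perturbedDict_cubeVertex_mem_neighborhood hD₀ hU hUD₀ hb hr hbr ε) le_rfl

end Risk

lemma exists_perturbation_size {p q r M : ℝ} (hp : 0 < p) (hq : 0 ≤ q) (hr : 0 < r) (hM : 0 < M)
    (hrp : r ^ 2 ≤ 4 * p) :
    ∃ b : ℝ, q * b ^ 2 ≤ 1 ∧ 2 * (p * (q * b ^ 2)) < r ^ 2 ∧ 4 * (M * b ^ 2) ≤ p ∧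
      p * (q * b ^ 2) / 2 = 1 / 8 * min (r ^ 2) (p ^ 2 * q / M) := by
  set A := min (r ^ 2 / (4 * p)) (p * q / (4 * M)) with A_def
  have A_le_left : A ≤ r ^ 2 / (4 * p) := min_le_left _ _
  have A_le_right : A ≤ p * q / (4 * M) := min_le_right _ _
  have A_nonneg : 0 ≤ A := by positivity
  have A_eq_zero : q = 0 → A = 0 := fun h =>
    le_antisymm (A_le_right.trans_eq (by simp [h])) A_nonneg
  have sq_b : √(A / q) ^ 2 = A / q := Real.sq_sqrt (by positivity)
  refine ⟨√(A / q), ?_⟩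
  rw [sq_b, mul_div_cancel_of_imp' A_eq_zero]
  refine ⟨A_le_left.trans ((div_le_one (by positivity)).2 hrp), ?_, ?_, ?_⟩
  · rw [le_div_iff₀ (by positivity)] at A_le_left
    linarith [pow_pos hr 2]
  · have : A / q ≤ p / (4 * M) :=
      div_le_of_le_mul₀ hq (by positivity) (A_le_right.trans_eq (by ring))
    rw [le_div_iff₀ (by positivity)] at this
    linarith
  · rw [A_def, mul_min_of_nonneg _ _ hp.le, ← min_div_div_right zero_le_two,
      mul_min_of_nonneg _ _ (by norm_num)]
    congr 1 <;> field_simp <;> ring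

lemma min_rate_le {p s m N r S : ℝ} (hs : 1 ≤ s) (hp : 0 ≤ p) (hm : 1 ≤ m) (hN : 0 ≤ N) :
    1 / 12960 * min (r ^ 2 / s) (p / (S ^ 2 * N * m ^ 2) * (p * (m - 1) / 10 - 1)) ≤
      1 / 8 * min (r ^ 2) (s * p ^ 2 * (m - 1) / (S ^ 2 * N * m ^ 2)) := by
  have : 0 ≤ m - 1 := sub_nonneg.2 hm
  have dim_nonneg : 0 ≤ p * (m - 1) := by positivity
  have dim_le : p * (m - 1) / 10 - 1 ≤ s * (p * (m - 1)) := by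
    linarith [le_mul_of_one_le_left dim_nonneg hs]
  have rate_le : p / (S ^ 2 * N * m ^ 2) * (p * (m - 1) / 10 - 1) ≤
      s * p ^ 2 * (m - 1) / (S ^ 2 * N * m ^ 2) :=
    (mul_le_mul_of_nonneg_left dim_le (by positivity)).trans_eq (by ring)
  have min_nonneg : 0 ≤ min (r ^ 2) (s * p ^ 2 * (m - 1) / (S ^ 2 * N * m ^ 2)) := by positivity
  linarith [min_le_min (div_le_self (sq_nonneg r) hs) rate_le]

end DictLearn

end

theorem theorem2_general (m p s N : ℕ) (hs : 1 ≤ s) (hsp : s ≤ p) (hN : 1 ≤ N)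
    (σ σa : ℝ) (hσ : 0 < σ) (hσa : 0 < σa) (r : ℝ) (hr₀ : 0 < r) (hr : r ≤ 2 * √(p : ℝ))
    (D₀ : Matrix (Fin m) (Fin p) ℝ) (hD₀ : D₀ ∈ DictLearn.obliqueManifold m p)
    (D : Matrix (Fin m) (Fin p) ℝ) (hD : D ∈ DictLearn.obliqueManifold m p) :
    ENNReal.ofReal (1 / 8 * min (r ^ 2)
        (s * p ^ 2 * (m - 1) / (DictLearn.SNR s σa σ D ^ 2 * N * m ^ 2)))
      ≤ DictLearn.minimaxRisk N s σa σ D₀ r := by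
  have hp : 0 < p := hs.trans hsp
  obtain ⟨q, rfl⟩ : ∃ q, m = q + 1 :=
    Nat.exists_eq_add_one.2 (DictLearn.pos_of_mem_obliqueManifold hp hD₀)
  have sq_r_le : r ^ 2 ≤ 4 * p :=
    calc r ^ 2 ≤ (2 * √(p : ℝ)) ^ 2 := by gcongr
      _ = 4 * (p : ℝ) := by rw [mul_pow, Real.sq_sqrt p.cast_nonneg]; norm_num
  choose U hU hUD₀ using fun k =>
    DictLearn.exists_orthonormal_rows (Fintype.card_fin (q + 1)) (hD₀ k)
  obtain ⟨b, hb, hbr, hbN, risk_eq⟩ := DictLearn.exists_perturbation_size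
    (q := q) (M := N * s * (σa ^ 2 / σ ^ 2) ^ 2) (Nat.cast_pos.2 hp) q.cast_nonneg hr₀
    (by positivity) sq_r_le
  have rate_eq : s * p ^ 2 * (((q + 1 : ℕ) : ℝ) - 1) /
      (DictLearn.SNR s σa σ D ^ 2 * N * ((q + 1 : ℕ) : ℝ) ^ 2) =
        p ^ 2 * q / (N * s * (σa ^ 2 / σ ^ 2) ^ 2) := by
    rw [DictLearn.SNR_eq hsp σa σ hD, Nat.cast_add_one, add_sub_cancel_right]
    field_simp
  rw [rate_eq, ← risk_eq]
  simpa only [Fintype.card_fin] using DictLearn.ofReal_le_minimaxRisk hsp hD₀ hU hUD₀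
    (by simpa only [Fintype.card_fin] using hb) hσ.ne' hr₀
    (by simpa only [Fintype.card_fin] using hbr) hbN

theorem theorem2 (m p s N : ℕ) (hmp : m ≤ p) (hs : 1 ≤ s) (hsp : s ≤ p) (hN : 1 ≤ N)
    (hdim : 50 ≤ (p : ℝ) * ((m : ℝ) - 1))
    (σ σa : ℝ) (hσ : 0 < σ) (hσa : 0 < σa)
    (r : ℝ) (hr : r ≤ 2 * √(p : ℝ))
    (D₀ : Matrix (Fin m) (Fin p) ℝ) (hD₀ : D₀ ∈ DictLearn.obliqueManifold m p)
    (D : Matrix (Fin m) (Fin p) ℝ) (hD : D ∈ DictLearn.neighborhood D₀ r)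
    (δ : ℝ) (hδ : δ ≤ 1 / 2) (hRIP : DictLearn.RIP D s δ)
    (hSNR : DictLearn.SNR s σa σ D ≤ (1 / (9 * √80)) * ((m : ℝ) / (2 * (s : ℝ)))) :
    ENNReal.ofReal ((1 / 12960) *
        min (r ^ 2 / (s : ℝ))
          ((p : ℝ) / (DictLearn.SNR s σa σ D ^ 2 * (N : ℝ) * (m : ℝ) ^ 2) *
            ((p : ℝ) * ((m : ℝ) - 1) / 10 - 1)))
      ≤ DictLearn.minimaxRisk N s σa σ D₀ r :=
  (ENNReal.ofReal_le_ofReal (DictLearn.min_rate_le (by exact_mod_cast hs) p.cast_nonneg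
    (by exact_mod_cast DictLearn.pos_of_mem_obliqueManifold (hs.trans hsp) hD₀)
    N.cast_nonneg)).trans
      (theorem2_general m p s N hs hsp hN σ σa hσ hσa r ((Real.sqrt_nonneg _).trans_lt hD.2) hr
        D₀ hD₀ D hD.1)
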